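/- Let $\mathbb F$ be an algebraically closed field of characteristic $p>3$, let $\alpha\in\mathbb F\setminus\{0,-1\}$, and let $\mathfrak g=D(2,1;\alpha)$ be the 17-dimensional Lie superalgebra with $\mathfrak g_{\bar 0}=\mathrm{sl}(2)_1\oplus\mathrm{sl}(2)_2\oplus\mathrm{sl}(2)_3$ and $\mathfrak g_{\bar 1}=V_1\boxtimes V_2\boxtimes V_3$, where $V_i$ is the natural $\mathrm{sl}(2)_i$-module with basis $\omega_i,\omega_{-i}$. Let $h_i,e_i,f_i$ be the standard basis of $\mathrm{sl}(2)_i$ ($[e_i,f_i]=h_i$, $[h_i,e_i]=2e_i$, $[h_i,f_i]=-2f_i$, $e_i\omega_{-i}=\omega_i$, $f_i\omega_i=\omega_{-i}$, $h_i\omega_{\pm i}=\pm\omega_{\pm i}$). Write $x_1,x_2,x_3,x_4$ for $\omega_1\otimes\omega_{\pm2}\otimes\omega_{\pm3}$ with signs $(+,+),(+,-),(-,+),(-,-)$, and $y_1,\dots,y_4$ for the same with $\omega_{-1}$ in place of $\omega_1$. The nonzero brackets of odd basis vectors are, up to the symmetry $[u,v]=[v,u]$, \begin{align*} &[x_1,y_2]=-2e_2,\quad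 [x_1,y_3]=-2\alpha e_3,\quad [x_1,y_4]=-(1+\alpha)h_1+h_2+\alpha h_3,\\ &[x_2,y_1]=2e_2,\quad [x_2,y_4]=2\alpha f_3,\quad [x_2,y_3]=(1+\alpha)h_1-h_2+\alpha h_3,\\ &[x_3,y_1]=2\alpha e_3,\quad [x_3,y_4]=2f_2,\quad [x_3,y_2]=(1+\alpha)h_1+h_2-\alpha h_3,\\ &[x_4,y_2]=-2\alpha f_3,\quad [x_4,y_3]=-2f_2,\quad [x_4,y_1]=-(1+\alpha)h_1-h_2-\alpha h_3,\\ &[y_2,y_3]=2(1+\alpha)f_1,\quad [y_1,y_4]=-2(1+\alpha)f_1,\quad [x_2,x_3]=-2(1+\alpha)e_1,\quad [x_1,x_4]=2(1+\alpha)e_1. \end{align*} Let $\mathfrak h=\mathrm{span}\{h_1,h_2,h_3\}$ and $\mathfrak n^+=\mathrm{span}\{e_1,e_2,e_3,x_1,x_2,x_3,x_4\}$, and let $[p]$ be the $p$-mapping on $\mathfrak g_{\bar 0}$ with $h_i^{[p]}=h_i$, $e_i^{[p]}=f_i^{[p]}=0$. For $\chi\in\mathfrak g_{\bar 0}^*$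 and a restricted subalgebra $\mathfrak s\subseteq\mathfrak g$, let $u_\chi(\mathfrak s)$ be the quotient of the universal enveloping algebra of $\mathfrak s$ by the ideal generated by the elements $x^p-x^{[p]}-\chi(x)^p$, $x\in\mathfrak s_{\bar 0}$. Let $\chi\in\mathfrak g_{\bar 0}^*$ vanish on $\mathfrak n^+\cap\mathfrak g_{\bar 0}$, and let $\lambda\in\mathfrak h^*$ satisfy $\lambda(h)^p-\lambda(h^{[p]})=\chi(h)^p$ for all $h\in\mathfrak h$. Let $Z=Z_\chi(\lambda)=u_\chi(\mathfrak g)\otimes_{u_\chi(\mathfrak h\oplus\mathfrak n^+)}K_\lambda$ be the baby Verma module, where $K_\lambda=\mathbb F v$ with $v$ even, $hv=\lambda(h)v$ for $h\in\mathfrak h$ and $\mathfrak n^+v=0$. A homogeneous linear map $\varphi:\mathfrak g\to Z$ of parity $|\varphi|$ is a derivation if $\varphi([x,y])=(-1)^{|\varphi||x|}x\varphi(y)-(-1)^{|y|(|\varphi|+|x|)}y\varphi(x)$ for all homogeneous $x,y\in\mathfrak g$. Let $\mathrm{Der}(\mathfrak g,Z)$ be the span of the homogeneous derivations, and let $\mathrm{Ider}(\mathfrak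 g,Z)$ be the span of the inner derivations $\mathfrak D_m$ with $m\in Z$ homogeneous, where $\mathfrak D_m(x)=(-1)^{|x||m|}xm$ for homogeneous $x\in\mathfrak g$. A subscript $(0)$ denotes the subspace of those $\varphi$ with $\varphi(\mathfrak g_\beta)\subseteq Z_\beta$ for all $\beta\in\mathfrak h^*$, where $\mathfrak g_\beta$ and $Z_\beta$ are the weight spaces with respect to $\mathfrak h$. Put $\mathrm H^1(\mathfrak g,Z)=\mathrm{Der}(\mathfrak g,Z)/\mathrm{Ider}(\mathfrak g,Z)$. If $\chi(f_1)^p\neq0$, then every $\varphi\in\mathrm{Der}(\mathfrak g,Z)_{(0)}$ lies in $\mathrm{Ider}(\mathfrak g,Z)_{(0)}$, and $\mathrm H^1(\mathfrak g,Z)=0$. -/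

import Mathlib

open scoped TensorProduct

noncomputable section

namespace D21

/-! ### The Lie superalgebra `D(2,1;α)` -/

/-- Labels of the standard basis of `D(2,1;α)`.  Indices are shifted by one:
`h i`, `e i`, `f i` (`i = 0,1,2`) is the standard basis of the `(i+1)`-st copy of `sl(2)`, and
`x k`, `y k` (`k = 0,1,2,3`) are the tensors `ω_{±1} ⊗ ω_{±2} ⊗ ω_{±3}`:
`x 0, x 1, x 2, x 3 = (+++), (++-), (+-+), (+--)` and
`y 0, y 1, y 2, y 3 = (-++), (-+-), (--+), (---)`. -/
inductive Idx : Type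
  | h (i : Fin 3)
  | e (i : Fin 3)
  | f (i : Fin 3)
  | x (k : Fin 4)
  | y (k : Fin 4)
  deriving DecidableEq, Fintype

open Idx

/-- The parity of a basis vector. -/
def par : Idx → ZMod 2
  | h _ => 0
  | e _ => 0
  | f _ => 0
  | x _ => 1
  | y _ => 1

/-- The underlying 17-dimensional vector space. -/
abbrev G (F : Type*) : Type _ := Idx → F

/-- The basis vector with label `a`. -/
def bv (F : Type*) [Zero F] [One F] (a : Idx) : G F := Pi.single a 1

/-- The listed brackets of basis vectors (each unordered pair is listed in at most one order; the
pairs that are not listed, in either order, have bracket zero). -/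
def half {F : Type*} [CommRing F] (α : F) : Idx → Idx → G F
  -- the three copies of `sl(2)`
  | e i, f j => if i = j then bv F (h i) else 0
  | h i, e j => if i = j then (2 : F) • bv F (e i) else 0
  | h i, f j => if i = j then (-2 : F) • bv F (f i) else 0
  -- the first copy acting on the odd part
  | h 0, x k => bv F (x k)
  | h 0, y k => -bv F (y k)
  | e 0, y k => bv F (x k)
  | f 0, x k => bv F (y k)
  -- the second copy acting on the odd part
  | h 1, x k => if k = 0 ∨ k = 1 then bv F (x k) else -bv F (x k)
  | h 1, y k => if k = 0 ∨ k = 1 then bv F (y k) else -bv F (y k)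
  | e 1, x 2 => bv F (x 0)
  | e 1, x 3 => bv F (x 1)
  | e 1, y 2 => bv F (y 0)
  | e 1, y 3 => bv F (y 1)
  | f 1, x 0 => bv F (x 2)
  | f 1, x 1 => bv F (x 3)
  | f 1, y 0 => bv F (y 2)
  | f 1, y 1 => bv F (y 3)
  -- the third copy acting on the odd part
  | h 2, x k => if k = 0 ∨ k = 2 then bv F (x k) else -bv F (x k)
  | h 2, y k => if k = 0 ∨ k = 2 then bv F (y k) else -bv F (y k)
  | e 2, x 1 => bv F (x 0)
  | e 2, x 3 => bv F (x 2)
  | e 2, y 1 => bv F (y 0)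
  | e 2, y 3 => bv F (y 2)
  | f 2, x 0 => bv F (x 1)
  | f 2, x 2 => bv F (x 3)
  | f 2, y 0 => bv F (y 1)
  | f 2, y 2 => bv F (y 3)
  -- brackets of odd elements
  | x 0, y 1 => (-2 : F) • bv F (e 1)
  | x 0, y 2 => (-2 * α) • bv F (e 2)
  | x 0, y 3 => -(1 + α) • bv F (h 0) + bv F (h 1) + α • bv F (h 2)
  | x 1, y 0 => (2 : F) • bv F (e 1)
  | x 1, y 3 => (2 * α) • bv F (f 2)
  | x 1, y 2 => (1 + α) • bv F (h 0) - bv F (h 1) + α • bv F (h 2)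
  | x 2, y 0 => (2 * α) • bv F (e 2)
  | x 2, y 3 => (2 : F) • bv F (f 1)
  | x 2, y 1 => (1 + α) • bv F (h 0) + bv F (h 1) - α • bv F (h 2)
  | x 3, y 1 => (-2 * α) • bv F (f 2)
  | x 3, y 2 => (-2 : F) • bv F (f 1)
  | x 3, y 0 => -(1 + α) • bv F (h 0) - bv F (h 1) - α • bv F (h 2)
  | y 1, y 2 => (2 * (1 + α)) • bv F (f 0)
  | y 0, y 3 => (-2 * (1 + α)) • bv F (f 0)
  | x 1, x 2 => (-2 * (1 + α)) • bv F (e 0)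
  | x 0, x 3 => (2 * (1 + α)) • bv F (e 0)
  | _, _ => 0

/-- The bracket of two basis vectors, `[a, b] = -(-1)^{|a||b|} [b, a]`. -/
def tab {F : Type*} [CommRing F] (α : F) (a b : Idx) : G F :=
  half α a b - (-1 : F) ^ (par a * par b).val • half α b a

variable {F : Type*} [Field F]

/-- The bracket of `D(2,1;α)`. -/
def br (α : F) : G F →ₗ[F] G F →ₗ[F] G F :=
  (Pi.basisFun F Idx).constr F fun a => (Pi.basisFun F Idx).constr F fun b => tab α a b

variable (F) in
/-- The subspace spanned by a set of basis vectors. -/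
def spanOf (s : Set Idx) : Submodule F (G F) := Submodule.span F (bv F '' s)

variable (F) in
/-- The homogeneous components `𝔤_0` (`i = 0`) and `𝔤_1` (`i = 1`). -/
def gr (i : ZMod 2) : Submodule F (G F) := spanOf F {a | par a = i}

variable (F) in
/-- The Cartan subalgebra `𝔥`, spanned by `h_1, h_2, h_3`. -/
def cartan : Submodule F (G F) := spanOf F (Set.range h)

variable (F) in
/-- `𝔫⁺`, spanned by the `e_i` and the `x_k`. -/
def nplus : Submodule F (G F) := spanOf F (Set.range e ∪ Set.range x)

variable (F) in
/-- `𝔥 ⊕ 𝔫⁺`. -/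
def borel : Submodule F (G F) := cartan F ⊔ nplus F

/-- The `p`-mapping on `𝔤_0 = sl(2) ⊕ sl(2) ⊕ sl(2)`.  On each copy of `sl(2)` it is the `p`-th
power of 2×2 matrices: `X = a h + b e + c f` has `X² = (a² + b c) · 1`, so
`X ^ p = (a² + b c) ^ ((p - 1) / 2) • X` for odd `p`.  It is the unique `p`-mapping with
`h_i ↦ h_i`, `e_i ↦ 0`, `f_i ↦ 0`.  (Only its values on `𝔤_0` are used.) -/
def pMap (p : ℕ) (v : G F) : G F
  | h i => (v (h i) ^ 2 + v (e i) * v (f i)) ^ ((p - 1) / 2) * v (h i)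
  | e i => (v (h i) ^ 2 + v (e i) * v (f i)) ^ ((p - 1) / 2) * v (e i)
  | f i => (v (h i) ^ 2 + v (e i) * v (f i)) ^ ((p - 1) / 2) * v (f i)
  | x _ => 0
  | y _ => 0

/-! ### Reduced enveloping algebras -/

/-- The defining relations of the `χ`-reduced enveloping algebra of a restricted subalgebra `S`:
`x y = (-1)^{|x||y|} y x + [x, y]` for homogeneous `x, y` in `S`, and
`x ^ p = x^{[p]} + χ(x) ^ p` for even `x` in `S`. -/
inductive RedRel (α : F) (p : ℕ) (χ : Module.Dual F (gr F 0)) (S : Submodule F (G F)) :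
    TensorAlgebra F S → TensorAlgebra F S → Prop
  | lie (i j : ZMod 2) (u v w : S) (hu : (u : G F) ∈ gr F i) (hv : (v : G F) ∈ gr F j)
      (hw : (w : G F) = br α u v) :
      RedRel α p χ S (TensorAlgebra.ι F u * TensorAlgebra.ι F v)
        ((-1 : F) ^ (i * j).val • (TensorAlgebra.ι F v * TensorAlgebra.ι F u)
          + TensorAlgebra.ι F w)
  | pow (u w : S) (hu : (u : G F) ∈ gr F 0) (hw : (w : G F) = pMap p (u : G F)) :
      RedRel α p χ S (TensorAlgebra.ι F u ^ p)
        (TensorAlgebra.ι F w + algebraMap F _ (χ ⟨u, hu⟩ ^ p))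

/-- The `χ`-reduced enveloping algebra `u_χ(S)` of a restricted subalgebra `S` of `D(2,1;α)`. -/
def RedEnv (α : F) (p : ℕ) (χ : Module.Dual F (gr F 0)) (S : Submodule F (G F)) : Type _ :=
  RingQuot (RedRel α p χ S)

instance (α : F) (p : ℕ) (χ : Module.Dual F (gr F 0)) (S : Submodule F (G F)) :
    Ring (RedEnv α p χ S) :=
  inferInstanceAs (Ring (RingQuot (RedRel α p χ S)))

instance (α : F) (p : ℕ) (χ : Module.Dual F (gr F 0)) (S : Submodule F (G F)) :
    Algebra F (RedEnv α p χ S) :=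
  inferInstanceAs (Algebra F (RingQuot (RedRel α p χ S)))

/-- The quotient map from the tensor algebra. -/
def RedEnv.mk (α : F) (p : ℕ) (χ : Module.Dual F (gr F 0)) (S : Submodule F (G F)) :
    TensorAlgebra F S →ₐ[F] RedEnv α p χ S :=
  RingQuot.mkAlgHom F (RedRel α p χ S)

lemma RedEnv.mk_rel (α : F) (p : ℕ) (χ : Module.Dual F (gr F 0)) (S : Submodule F (G F))
    {a b : TensorAlgebra F S} (hab : RedRel α p χ S a b) :
    RedEnv.mk α p χ S a = RedEnv.mk α p χ S b :=
  RingQuot.mkAlgHom_rel F hab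

/-- Algebra maps out of the `χ`-reduced enveloping algebra. -/
def RedEnv.lift (α : F) (p : ℕ) (χ : Module.Dual F (gr F 0)) (S : Submodule F (G F))
    {A : Type*} [Ring A] [Algebra F A] (g : S →ₗ[F] A)
    (hg : ∀ a b, RedRel α p χ S a b → TensorAlgebra.lift F g a = TensorAlgebra.lift F g b) :
    RedEnv α p χ S →ₐ[F] A :=
  RingQuot.liftAlgHom F ⟨TensorAlgebra.lift F g, fun {a b} hab => hg a b hab⟩

/-- The canonical map `S → u_χ(S)`. -/
def RedEnv.ι (α : F) (p : ℕ) (χ : Module.Dual F (gr F 0)) (S : Submodule F (G F)) :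
    S →ₗ[F] RedEnv α p χ S :=
  (RedEnv.mk α p χ S).toLinearMap ∘ₗ TensorAlgebra.ι F

/-- `u_χ(𝔤)`. -/
abbrev U (α : F) (p : ℕ) (χ : Module.Dual F (gr F 0)) : Type _ := RedEnv α p χ ⊤

/-- The canonical map `𝔤 → u_χ(𝔤)`. -/
def ιU (α : F) (p : ℕ) (χ : Module.Dual F (gr F 0)) : G F →ₗ[F] U α p χ :=
  RedEnv.ι α p χ ⊤ ∘ₗ LinearMap.codRestrict ⊤ LinearMap.id fun _ => trivial

lemma RedEnv.lie_rel (α : F) (p : ℕ) (χ : Module.Dual F (gr F 0)) (S : Submodule F (G F))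
    (i j : ZMod 2) (u v w : S) (hu : (u : G F) ∈ gr F i) (hv : (v : G F) ∈ gr F j)
    (hw : (w : G F) = br α u v) :
    RedEnv.ι α p χ S u * RedEnv.ι α p χ S v =
      (-1 : F) ^ (i * j).val • (RedEnv.ι α p χ S v * RedEnv.ι α p χ S u) + RedEnv.ι α p χ S w := by
  simpa [RedEnv.ι] using RedEnv.mk_rel α p χ S (RedRel.lie (p := p) (χ := χ) i j u v w hu hv hw)

lemma RedEnv.pow_rel (α : F) (p : ℕ) (χ : Module.Dual F (gr F 0)) (S : Submodule F (G F))
    (u w : S) (hu : (u : G F) ∈ gr F 0) (hw : (w : G F) = pMap p (u : G F)) :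
    RedEnv.ι α p χ S u ^ p = RedEnv.ι α p χ S w + algebraMap F _ (χ ⟨u, hu⟩ ^ p) := by
  have := RedEnv.mk_rel α p χ S (RedRel.pow (α := α) (p := p) (χ := χ) u w hu hw)
  rw [map_pow, map_add, AlgHom.commutes] at this
  exact this

/-- The canonical algebra map `u_χ(S) → u_χ(𝔤)`. -/
def RedEnv.incl (α : F) (p : ℕ) (χ : Module.Dual F (gr F 0)) (S : Submodule F (G F)) :
    RedEnv α p χ S →ₐ[F] U α p χ :=
  RedEnv.lift α p χ S (ιU α p χ ∘ₗ S.subtype) (by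
    intro a b hab
    induction hab with
    | lie i j u v w hu hv hw =>
      have := RedEnv.lie_rel α p χ ⊤ i j ⟨u, trivial⟩ ⟨v, trivial⟩ ⟨w, trivial⟩ hu hv hw
      simp only [map_mul, map_add, map_smul, TensorAlgebra.lift_ι_apply]
      exact this
    | pow u w hu hw =>
      have := RedEnv.pow_rel α p χ ⊤ ⟨u, trivial⟩ ⟨w, trivial⟩ hu hw
      simp only [map_pow, map_add, AlgHom.commutes, TensorAlgebra.lift_ι_apply]
      rw [← map_pow (algebraMap F _)]
      exact this)

/-! ### The character of `u_χ(𝔥 ⊕ 𝔫⁺)` attached to a weight -/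

lemma bv_h_mem_cartan (i : Fin 3) : bv F (h i) ∈ cartan F :=
  Submodule.subset_span ⟨h i, ⟨i, rfl⟩, rfl⟩

lemma cartan_le_gr : cartan F ≤ gr F 0 :=
  Submodule.span_mono (Set.image_mono (by rintro _ ⟨i, rfl⟩; rfl))

/-- `Λ_χ = {λ ∈ 𝔥^* | λ(t)^p - λ(t^{[p]}) = χ(t)^p for all t ∈ 𝔥}`. -/
def weightSet (p : ℕ) (χ : Module.Dual F (gr F 0)) : Set (Module.Dual F (cartan F)) :=
  {l | ∀ t s : cartan F, (s : G F) = pMap p (t : G F) →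
    l t ^ p - l s = χ ⟨t, cartan_le_gr t.2⟩ ^ p}

/-- The linear form on `𝔤` that is `l` on `𝔥` and `0` on the root vectors.  On `𝔥 ⊕ 𝔫⁺` it gives
the action on the one-dimensional module `K_l`, where `𝔫⁺` acts by zero. -/
def extWeight (l : Module.Dual F (cartan F)) : G F →ₗ[F] F :=
  (Pi.basisFun F Idx).constr F fun
    | h i => l ⟨bv F (h i), bv_h_mem_cartan i⟩
    | _ => 0

lemma extWeight_bv (l : Module.Dual F (cartan F)) (a : Idx) :
    extWeight l (bv F a) =
      match a with
      | h i => l ⟨bv F (h i), bv_h_mem_cartan i⟩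
      | _ => 0 := by
  have : bv F a = Pi.basisFun F Idx a := by simp [bv]
  rw [this, extWeight, Module.Basis.constr_basis]

lemma br_bv (α : F) (a b : Idx) : br α (bv F a) (bv F b) = tab α a b := by
  have (c : Idx) : bv F c = Pi.basisFun F Idx c := by simp [bv]
  rw [this, this, br, Module.Basis.constr_basis, Module.Basis.constr_basis]

lemma mem_spanOf {s : Set Idx} {v : G F} : v ∈ spanOf F s ↔ ∀ a, a ∉ s → v a = 0 := by
  constructor
  · intro hv a ha
    induction hv using Submodule.span_induction with
    | mem x hx =>
      obtain ⟨b, hb, rfl⟩ := hx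
      have : a ≠ b := by rintro rfl; exact ha hb
      simp [bv, this]
    | zero => rfl
    | add x y _ _ hx hy => simp [hx, hy]
    | smul c x _ hx => simp [hx]
  · intro hv
    have : v = ∑ a, v a • bv F a := by
      ext b
      simp [bv, Finset.sum_apply, Pi.single_apply]
    rw [this]
    refine Submodule.sum_mem _ fun a _ => ?_
    by_cases ha : a ∈ s
    · exact Submodule.smul_mem _ _ (Submodule.subset_span ⟨a, ha, rfl⟩)
    · simp [hv a ha]

lemma extWeight_nplus (l : Module.Dual F (cartan F)) {u : G F} (hu : u ∈ nplus F) :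
    extWeight l u = 0 := by
  have : nplus F ≤ LinearMap.ker (extWeight l) := by
    rw [nplus, spanOf, Submodule.span_le]
    rintro _ ⟨a, ha, rfl⟩
    rcases ha with ⟨i, rfl⟩ | ⟨i, rfl⟩ <;> simp [extWeight_bv]
  exact this hu

lemma extWeight_cartan (l : Module.Dual F (cartan F)) (t : cartan F) :
    extWeight l t = l t := by
  obtain ⟨t, ht⟩ := t
  induction ht using Submodule.span_induction with
  | mem x hx =>
    obtain ⟨_, ⟨i, rfl⟩, rfl⟩ := hx
    simp [extWeight_bv]
  | zero => rw [map_zero]; exact (map_zero l).symm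
  | add x y hx hy h₁ h₂ =>
    simp only [map_add, h₁, h₂] at *
    rw [← map_add]; rfl
  | smul c x hx h₁ =>
    simp only [map_smul, h₁] at *
    rw [← map_smul]; rfl

lemma extWeight_odd (l : Module.Dual F (cartan F)) {u : G F} (hu : u ∈ gr F 1) :
    extWeight l u = 0 := by
  have : gr F 1 ≤ LinearMap.ker (extWeight l) := by
    rw [gr, spanOf, Submodule.span_le]
    rintro _ ⟨a, ha, rfl⟩
    cases a <;> simp_all [extWeight_bv, par]
  exact this hu

lemma borel_eq : borel F = spanOf F (Set.range h ∪ (Set.range e ∪ Set.range x)) := by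
  rw [borel, cartan, nplus, spanOf, spanOf, spanOf, ← Submodule.span_union, ← Set.image_union]

lemma extWeight_half (α : F) (l : Module.Dual F (cartan F)) {a b : Idx}
    (ha : a ∈ Set.range h ∪ (Set.range e ∪ Set.range x))
    (hb : b ∈ Set.range h ∪ (Set.range e ∪ Set.range x)) : extWeight l (half α a b) = 0 := by
  unfold half
  split <;> simp at ha hb ⊢ <;> (try split_ifs) <;> simp [extWeight_bv]

lemma extWeight_br (α : F) (l : Module.Dual F (cartan F)) {u v : G F} (hu : u ∈ borel F)
    (hv : v ∈ borel F) : extWeight l (br α u v) = 0 := by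
  rw [borel_eq] at hu hv
  induction hu, hv using Submodule.span_induction₂ with
  | mem_mem a b ha hb =>
    obtain ⟨a, ha, rfl⟩ := ha
    obtain ⟨b, hb, rfl⟩ := hb
    rw [br_bv, tab, map_sub, map_smul, extWeight_half α l ha hb, extWeight_half α l hb ha]
    simp
  | zero_left _ _ => simp
  | zero_right _ _ => simp
  | add_left _ _ _ _ _ _ h₁ h₂ => simp [h₁, h₂]
  | add_right _ _ _ _ _ _ h₁ h₂ => simp [h₁, h₂]
  | smul_left _ _ _ _ _ h₁ => simp [h₁]
  | smul_right _ _ _ _ _ h₁ => simp [h₁]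

lemma extWeight_pow (p : ℕ) (χ : Module.Dual F (gr F 0))
    (hχ : ∀ v : gr F 0, (v : G F) ∈ nplus F → χ v = 0)
    (l : Module.Dual F (cartan F)) (hl : l ∈ weightSet p χ) {u : G F} (hu : u ∈ borel F)
    (hu0 : u ∈ gr F 0) :
    extWeight l u ^ p = extWeight l (pMap p u) + χ ⟨u, hu0⟩ ^ p := by
  obtain ⟨t, ht, n, hn, rfl⟩ := Submodule.mem_sup.mp hu
  have hn0 : n ∈ gr F 0 := by
    have := Submodule.sub_mem _ hu0 (cartan_le_gr ht)
    simpa using this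
  have hχt : χ ⟨t + n, hu0⟩ = χ ⟨t, cartan_le_gr ht⟩ := by
    have h₁ : (⟨t + n, hu0⟩ : gr F 0) = ⟨t, cartan_le_gr ht⟩ + ⟨n, hn0⟩ := rfl
    rw [h₁, map_add, hχ ⟨n, hn0⟩ hn, add_zero]
  have htc := mem_spanOf.mp ht
  have hnc := mem_spanOf.mp hn
  have hs : pMap p t ∈ cartan F := by
    refine mem_spanOf.mpr fun a ha => ?_
    have := htc a ha
    cases a <;> simp_all [pMap]
  have hd : pMap p (t + n) - pMap p t ∈ nplus F := by
    refine mem_spanOf.mpr fun a ha => ?_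
    have h₁ := hnc a ha
    cases a with
    | h i =>
      have h₂ := hnc (f i) (by simp)
      have h₃ := htc (f i) (by simp)
      simp [pMap, h₁, h₂, h₃]
    | f i =>
      have h₃ := htc (f i) (by simp)
      simp [pMap, h₁, h₃]
    | e i => simp at ha
    | x k => simp [pMap]
    | y k => simp [pMap]
  have h₁ := extWeight_nplus l hd
  rw [map_sub, sub_eq_zero] at h₁
  have h₂ := hl ⟨t, ht⟩ ⟨pMap p t, hs⟩ rfl
  rw [h₁, hχt, map_add, extWeight_nplus l hn, add_zero]
  have h₃ := extWeight_cartan l ⟨t, ht⟩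
  have h₄ := extWeight_cartan l ⟨pMap p t, hs⟩
  simp only at h₃ h₄
  rw [h₃, h₄, ← h₂]
  ring

/-- The action of `u_χ(𝔥 ⊕ 𝔫⁺)` on the one-dimensional module `K_l`: `t ∈ 𝔥` acts as `l t`
and `𝔫⁺` acts as zero. -/
def charK (α : F) (p : ℕ) (χ : Module.Dual F (gr F 0))
    (hχ : ∀ v : gr F 0, (v : G F) ∈ nplus F → χ v = 0)
    (l : Module.Dual F (cartan F)) (hl : l ∈ weightSet p χ) :
    RedEnv α p χ (borel F) →ₐ[F] F :=
  RedEnv.lift α p χ (borel F) (extWeight l ∘ₗ (borel F).subtype) (by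
    intro a b hab
    induction hab with
    | lie i j u v w hu hv hw =>
      simp only [map_mul, map_add, map_smul, TensorAlgebra.lift_ι_apply, LinearMap.comp_apply,
        Submodule.subtype_apply, hw, extWeight_br α l u.2 v.2, add_zero, smul_eq_mul]
      by_cases hij : i = 1 ∧ j = 1
      · obtain ⟨rfl, rfl⟩ := hij
        simp [extWeight_odd l hu]
      · have : i * j = 0 := by
          clear hu hv; revert i j; decide
        simp [this, mul_comm]
    | pow u w hu hw =>
      simp only [map_pow, map_add, AlgHom.commutes, TensorAlgebra.lift_ι_apply,
        LinearMap.comp_apply, Submodule.subtype_apply, hw]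
      simpa using extWeight_pow p χ hχ l hl u.2 hu)

/-! ### The baby Verma module -/

section BabyVerma

variable (α : F) (p : ℕ) (χ : Module.Dual F (gr F 0))
  (hχ : ∀ v : gr F 0, (v : G F) ∈ nplus F → χ v = 0)
  (l : Module.Dual F (cartan F)) (hl : l ∈ weightSet p χ)

/-- The submodule of `u_χ(𝔤) ⊗_F K_l` generated by the elements `u b ⊗ k - u ⊗ b k` with
`u ∈ u_χ(𝔤)`, `b ∈ u_χ(𝔥 ⊕ 𝔫⁺)` and `k ∈ K_l = F`. -/
def balancing : Submodule (U α p χ) (U α p χ ⊗[F] F) :=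
  Submodule.span _ {m | ∃ (u : U α p χ) (b : RedEnv α p χ (borel F)) (k : F),
    m = (u * RedEnv.incl α p χ (borel F) b) ⊗ₜ[F] k - u ⊗ₜ[F] (charK α p χ hχ l hl b * k)}

/-- The baby Verma module `Z_χ(l) = u_χ(𝔤) ⊗_{u_χ(𝔥 ⊕ 𝔫⁺)} K_l`: the tensor product over the
noncommutative ring `u_χ(𝔥 ⊕ 𝔫⁺)` is the quotient of the tensor product over `F` by the
balancing relations. -/
abbrev Z : Type _ := (U α p χ ⊗[F] F) ⧸ balancing α p χ hχ l hl

/-- The action of `𝔤` on `Z_χ(l)`. -/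
def act : G F →ₗ[F] Module.End F (Z α p χ hχ l hl) :=
  (Algebra.lsmul F F (Z α p χ hχ l hl)).toLinearMap ∘ₗ ιU α p χ

/-- The homogeneous component of parity `i` of `u_χ(𝔤)`: it is spanned by the products of basis
vectors of `𝔤` whose parities add up to `i`. -/
def grU (i : ZMod 2) : Submodule F (U α p χ) :=
  Submodule.span F {u | ∃ w : List Idx, (w.map par).sum = i ∧
    u = (w.map fun a => ιU α p χ (bv F a)).prod}

/-- The homogeneous component of parity `i` of `Z_χ(l)`; the generator `1 ⊗ v` is even. -/
def grZ (i : ZMod 2) : Submodule F (Z α p χ hχ l hl) :=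
  Submodule.span F {m | ∃ u ∈ grU α p χ i, m = Submodule.Quotient.mk (u ⊗ₜ[F] (1 : F))}

end BabyVerma

/-! ### Superderivations and the first cohomology

`M` is a module over `𝔤 = D(2,1;α)`, given by the action `ρ` and the homogeneous components
`P 0`, `P 1`. -/

section Derivations

variable {M : Type*} [AddCommGroup M] [Module F M]

/-- `φ` is a homogeneous derivation of parity `k`: it maps `𝔤_i` to `M_{k+i}`, and
`φ [u, v] = (-1)^{k|u|} u φ(v) - (-1)^{|v|(k+|u|)} v φ(u)` for homogeneous `u, v`. -/
def IsHomDer (α : F) (ρ : G F →ₗ[F] Module.End F M) (P : ZMod 2 → Submodule F M) (k : ZMod 2)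
    (φ : G F →ₗ[F] M) : Prop :=
  (∀ i, ∀ u ∈ gr F i, φ u ∈ P (k + i)) ∧
  ∀ i j, ∀ u ∈ gr F i, ∀ v ∈ gr F j,
    φ (br α u v) = (-1 : F) ^ (k * i).val • ρ u (φ v) - (-1 : F) ^ (j * (k + i)).val • ρ v (φ u)

/-- `Der(𝔤, M)`, the span of the homogeneous derivations. -/
def Der (α : F) (ρ : G F →ₗ[F] Module.End F M) (P : ZMod 2 → Submodule F M) :
    Submodule F (G F →ₗ[F] M) :=
  Submodule.span F {φ | ∃ k, IsHomDer α ρ P k φ}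

/-- The inner derivation `𝔇_m` with respect to a homogeneous `m` of parity `k`:
`𝔇_m(u) = (-1)^{|u| k} u m` for homogeneous `u`. -/
def innerDer (ρ : G F →ₗ[F] Module.End F M) (k : ZMod 2) (m : M) : G F →ₗ[F] M :=
  (Pi.basisFun F Idx).constr F fun a => (-1 : F) ^ (par a * k).val • ρ (bv F a) m

/-- `Ider(𝔤, M)`, the span of the inner derivations with respect to homogeneous elements. -/
def Ider (ρ : G F →ₗ[F] Module.End F M) (P : ZMod 2 → Submodule F M) :
    Submodule F (G F →ₗ[F] M) :=
  Submodule.span F {φ | ∃ k, ∃ m ∈ P k, φ = innerDer ρ k m}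

/-- The weight space of weight `β ∈ 𝔥^*` for a family `T` of endomorphisms indexed by `𝔥`. -/
def wtSpace {V : Type*} [AddCommGroup V] [Module F V] (T : G F →ₗ[F] Module.End F V)
    (β : Module.Dual F (cartan F)) : Submodule F V :=
  ⨅ t : cartan F, Module.End.eigenspace (T t) (β t)

/-- The linear maps `φ : 𝔤 → M` with `φ(𝔤_β) ⊆ M_β` for all `β ∈ 𝔥^*`. -/
def weightPreserving (α : F) (ρ : G F →ₗ[F] Module.End F M) : Submodule F (G F →ₗ[F] M) where
  carrier := {φ | ∀ β, ∀ u ∈ wtSpace (br α) β, φ u ∈ wtSpace ρ β}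
  add_mem' h₁ h₂ β u hu := add_mem (h₁ β u hu) (h₂ β u hu)
  zero_mem' _ _ _ := zero_mem _
  smul_mem' c _ h₁ β u hu := Submodule.smul_mem _ c (h₁ β u hu)

/-- The `0`-weight derivation space `Der(𝔤, M)_(0)`. -/
def Der0 (α : F) (ρ : G F →ₗ[F] Module.End F M) (P : ZMod 2 → Submodule F M) :
    Submodule F (G F →ₗ[F] M) :=
  Der α ρ P ⊓ weightPreserving α ρ

/-- The inner derivations in the `0`-weight space, `Ider(𝔤, M)_(0)`. -/
def Ider0 (α : F) (ρ : G F →ₗ[F] Module.End F M) (P : ZMod 2 → Submodule F M) :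
    Submodule F (G F →ₗ[F] M) :=
  Ider ρ P ⊓ weightPreserving α ρ

/-- The first cohomology `H¹(𝔤, M) = Der(𝔤, M) / Ider(𝔤, M)`. -/
abbrev H1 (α : F) (ρ : G F →ₗ[F] Module.End F M) (P : ZMod 2 → Submodule F M) : Type _ :=
  Der α ρ P ⧸ (Ider ρ P).submoduleOf (Der α ρ P)

end Derivations

lemma bv_f_mem_gr (i : Fin 3) : bv F (f i) ∈ gr F 0 :=
  Submodule.subset_span ⟨f i, rfl, rfl⟩

end D21

end

/-!
If `u` is even, then `u ^ p - u^{[p]}` is central in the enveloping algebra of `𝔤`. It acts by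
`χ(u) ^ p` on a module `M` over `u_χ(𝔤)` and by `0` on the trivial module, so `χ(u) ^ p`
annihilates `H¹(𝔤, M) = Ext¹(F, M)`. Explicitly, let `T u` be the action of `u` on linear maps
`𝔤 → M`. A derivation `φ` satisfies `T u φ = 𝔇_{φ(u)}`, and `T u 𝔇_m = 𝔇_{u m}`, hence
`(T u) ^ p φ = 𝔇_{u ^ (p - 1) φ(u)}`. On the other hand `(T u) ^ p = T (u^{[p]}) + χ(u) ^ p`, so
that `χ(u) ^ p φ = 𝔇_{u ^ (p - 1) φ(u)} - 𝔇_{φ(u^{[p]})}`. A nonzero `χ` is nonzero on some even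
basis vector `u`.
-/

namespace D21

open Idx

section HomAct

variable {V M : Type*} [AddCommGroup V] [AddCommGroup M]

variable {R : Type*} [CommRing R] [Module R V] [Module R M]

/-- The action `ψ ↦ a ∘ ψ - ψ ∘ d` on linear maps `V → M` of an even element of a Lie superalgebra
that acts by `d` on `V` and by `a` on `M`. -/
def homAct (d : Module.End R V) (a : Module.End R M) : Module.End R (V →ₗ[R] M) :=
  LinearMap.llcomp R V M M a - LinearMap.lcomp R M d

lemma homAct_apply (d : Module.End R V) (a : Module.End R M) (ψ : V →ₗ[R] M) (v : V) :
    homAct d a ψ v = a (ψ v) - ψ (d v) := rfl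

lemma llcomp_pow (a : Module.End R M) (n : ℕ) :
    (LinearMap.llcomp R V M M a : Module.End R (V →ₗ[R] M)) ^ n =
      LinearMap.llcomp R V M M (a ^ n) := by
  induction n with
  | zero => rfl
  | succ n ih => rw [pow_succ, ih, pow_succ]; rfl

lemma lcomp_pow (d : Module.End R V) (n : ℕ) :
    (LinearMap.lcomp R M d : Module.End R (V →ₗ[R] M)) ^ n = LinearMap.lcomp R M (d ^ n) := by
  induction n with
  | zero => rfl
  | succ n ih => rw [pow_succ, ih, pow_succ']; rfl

lemma homAct_pow_char {F : Type*} [Field F] [Module F V] [Module F M] (p : ℕ) [CharP F p]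
    [Fact p.Prime] (d : Module.End F V) (a : Module.End F M) :
    homAct d a ^ p = homAct (d ^ p) (a ^ p) := by
  cases subsingleton_or_nontrivial (Module.End F (V →ₗ[F] M))
  · exact Subsingleton.elim _ _
  have : CharP (Module.End F (V →ₗ[F] M)) p :=
    charP_of_injective_algebraMap (algebraMap F _).injective p
  have hcomm : Commute (LinearMap.llcomp F V M M a) (LinearMap.lcomp F M d) := rfl
  rw [homAct, sub_pow_char_of_commute p hcomm, llcomp_pow, lcomp_pow, homAct]

end HomAct

variable {F : Type*} [Field F]

section Bracket

lemma bv_mem_spanOf {s : Set Idx} {a : Idx} (ha : a ∈ s) : bv F a ∈ spanOf F s :=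
  Submodule.subset_span (Set.mem_image_of_mem _ ha)

lemma spanOf_mono {s t : Set Idx} (hst : s ⊆ t) : spanOf F s ≤ spanOf F t :=
  Submodule.span_mono (Set.image_mono hst)

lemma bv_mem_gr (a : Idx) : bv F a ∈ gr F (par a) :=
  bv_mem_spanOf rfl

lemma linearMap_ext_bv {V : Type*} [AddCommGroup V] [Module F V] {g g' : G F →ₗ[F] V}
    (hg : ∀ a, g (bv F a) = g' (bv F a)) : g = g' :=
  (Pi.basisFun F Idx).ext fun a => by simpa [bv] using hg a

/-- The eigenvalue of `h i` on the basis vector with label `a`, that is, a coordinate of its root.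
It is kept in `ℤ`, where the bound `|wt i a| ≤ 2` shows that root vectors are ad-nilpotent. -/
def wt (i : Fin 3) : Idx → ℤ
  | h _ => 0
  | e j => if i = j then 2 else 0
  | f j => if i = j then -2 else 0
  | x k => ![1, ![1, 1, -1, -1] k, ![1, -1, 1, -1] k] i
  | y k => ![-1, ![1, 1, -1, -1] k, ![1, -1, 1, -1] k] i

lemma abs_wt_le (i : Fin 3) (a : Idx) : |wt i a| ≤ 2 := by
  revert i a; decide

lemma half_mem_spanOf (α : F) (a b : Idx) :
    half α a b ∈ spanOf F {c | par c = par a + par b ∧ ∀ i, wt i c = wt i a + wt i b} := by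
  unfold half
  split
  all_goals
    try split_ifs
    all_goals
      subst_vars
      repeat' first
        | apply zero_mem
        | apply add_mem
        | apply sub_mem
        | apply neg_mem
        | apply Submodule.smul_mem
        | apply bv_mem_spanOf
      all_goals decide +revert

lemma br_bv_mem_spanOf (α : F) (a b : Idx) :
    br α (bv F a) (bv F b) ∈
      spanOf F {c | par c = par a + par b ∧ ∀ i, wt i c = wt i a + wt i b} := by
  rw [br_bv, tab]
  refine sub_mem (half_mem_spanOf α a b) (Submodule.smul_mem _ _ ?_)
  simpa only [add_comm (par b), add_comm (wt _ b)] using half_mem_spanOf α b a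

lemma br_mem_gr (α : F) {i j : ZMod 2} {u v : G F} (hu : u ∈ gr F i) (hv : v ∈ gr F j) :
    br α u v ∈ gr F (i + j) := by
  induction hu, hv using Submodule.span_induction₂ with
  | mem_mem _ _ ha hb =>
    obtain ⟨a, rfl, rfl⟩ := ha
    obtain ⟨b, rfl, rfl⟩ := hb
    exact spanOf_mono (fun _ hc => hc.1) (br_bv_mem_spanOf α a b)
  | zero_left _ _ => simp
  | zero_right _ _ => simp
  | add_left _ _ _ _ _ _ h₁ h₂ => simpa using add_mem h₁ h₂
  | add_right _ _ _ _ _ _ h₁ h₂ => simpa using add_mem h₁ h₂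
  | smul_left c _ _ _ _ h₁ => simpa using Submodule.smul_mem _ c h₁
  | smul_right c _ _ _ _ h₁ => simpa using Submodule.smul_mem _ c h₁

lemma br_bv_mem_spanOf_wt (α : F) (a : Idx) (i : Fin 3) {m : ℤ} {v : G F}
    (hv : v ∈ spanOf F {c | wt i c = m}) :
    br α (bv F a) v ∈ spanOf F {c | wt i c = wt i a + m} := by
  induction hv using Submodule.span_induction with
  | mem _ hb =>
    obtain ⟨b, rfl, rfl⟩ := hb
    exact spanOf_mono (fun _ hc => hc.2 i) (br_bv_mem_spanOf α a b)
  | zero => simp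
  | add _ _ _ _ hu hv => simpa only [map_add] using add_mem hu hv
  | smul c _ _ hu => simpa only [map_smul] using Submodule.smul_mem _ c hu

lemma br_bv_pow_three_eq_zero (α : F) {a : Idx} {i : Fin 3} (ha : |wt i a| = 2) :
    br α (bv F a) ^ 3 = 0 := by
  refine linearMap_ext_bv fun b => ?_
  have hb : bv F b ∈ spanOf F {c | wt i c = wt i b} := bv_mem_spanOf rfl
  have hmem := br_bv_mem_spanOf_wt α a i <| br_bv_mem_spanOf_wt α a i <|
    br_bv_mem_spanOf_wt α a i hb
  have hempty : {c | wt i c = wt i a + (wt i a + (wt i a + wt i b))} = ∅ := by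
    refine Set.eq_empty_of_forall_notMem fun c (hc : wt i c = _) => ?_
    have hc' := abs_le.mp (abs_wt_le i c)
    have hb' := abs_le.mp (abs_wt_le i b)
    rcases eq_or_eq_neg_of_abs_eq ha with h | h <;> omega
  rwa [hempty, spanOf, Set.image_empty, Submodule.span_empty, Submodule.mem_bot] at hmem

lemma tab_h (α : F) (i : Fin 3) (a : Idx) : tab α (h i) a = (wt i a : F) • bv F a := by
  rcases a with j | j | j | k | k
  · simp [tab, half, wt]
  · by_cases hij : i = j <;> simp [tab, half, wt, par, hij]
  · by_cases hij : i = j <;> simp [tab, half, wt, par, hij]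
  all_goals
    fin_cases i
    · simp [tab, half, wt, par]
    all_goals fin_cases k <;> simp [tab, half, wt, par]

lemma br_h_pow_char (p : ℕ) [CharP F p] [Fact p.Prime] (α : F) (i : Fin 3) :
    br α (bv F (h i)) ^ p = br α (bv F (h i)) := by
  refine linearMap_ext_bv fun a => ?_
  have hpow (n : ℕ) : (br α (bv F (h i)) ^ n) (bv F a) = (wt i a : F) ^ n • bv F a := by
    induction n with
    | zero => simp
    | succ n ih =>
      rw [pow_succ', Module.End.mul_apply, ih, map_smul, br_bv, tab_h, smul_smul, pow_succ]
  have fermat : (wt i a : F) ^ p = wt i a := map_intCast (frobenius F p) (wt i a)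
  rw [hpow, fermat, br_bv, tab_h]

lemma pMap_h (p : ℕ) (i : Fin 3) : pMap p (bv F (h i)) = bv F (h i) := by
  funext a
  cases a <;> simp +contextual [pMap, bv, Pi.single_apply]

lemma pMap_e {p : ℕ} (hp : 2 < p) (i : Fin 3) : pMap p (bv F (e i)) = 0 := by
  have hexp : (p - 1) / 2 ≠ 0 := by omega
  funext a
  cases a <;> simp [pMap, bv, hexp]

lemma pMap_f {p : ℕ} (hp : 2 < p) (i : Fin 3) : pMap p (bv F (f i)) = 0 := by
  have hexp : (p - 1) / 2 ≠ 0 := by omega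
  funext a
  cases a <;> simp [pMap, bv, hexp]

lemma br_bv_pow_char {p : ℕ} [CharP F p] [Fact p.Prime] (hp : 2 < p) (α : F) {a : Idx}
    (ha : par a = 0) : br α (bv F a) ^ p = br α (pMap p (bv F a)) := by
  match a, ha with
  | h i, _ => rw [pMap_h, br_h_pow_char]
  | e i, _ => rw [pMap_e hp, map_zero,
      pow_eq_zero_of_le hp (br_bv_pow_three_eq_zero α (i := i) (by simp [wt]))]
  | f i, _ => rw [pMap_f hp, map_zero,
      pow_eq_zero_of_le hp (br_bv_pow_three_eq_zero α (i := i) (by simp [wt]))]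

lemma pMap_mem_gr (p : ℕ) (u : G F) : pMap p u ∈ gr F 0 := by
  refine mem_spanOf.mpr fun a ha => ?_
  cases a <;> simp_all [par, pMap]

end Bracket

section Derivations

variable {M : Type*} [AddCommGroup M] [Module F M] {α : F} {ρ : G F →ₗ[F] Module.End F M}

lemma innerDer_of_mem_gr (ρ : G F →ₗ[F] Module.End F M) (k : ZMod 2) (m : M) {i : ZMod 2}
    {u : G F} (hu : u ∈ gr F i) : innerDer ρ k m u = (-1 : F) ^ (i * k).val • ρ u m := by
  induction hu using Submodule.span_induction with
  | mem _ ha =>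
    obtain ⟨a, rfl, rfl⟩ := ha
    have hbv : bv F a = Pi.basisFun F Idx a := by simp [bv]
    nth_rewrite 1 [hbv]
    exact Module.Basis.constr_basis ..
  | zero => simp
  | add u v _ _ hu hv => rw [map_add, map_add, hu, hv, LinearMap.add_apply, smul_add]
  | smul c u _ hu => rw [map_smul, map_smul, hu, LinearMap.smul_apply, smul_comm]

variable {P : ZMod 2 → Submodule F M} {k : ZMod 2} {φ : G F →ₗ[F] M} {u : G F}

lemma homAct_innerDer (hu : u ∈ gr F 0) (hρ : ∀ v, ρ (br α u v) = ⁅ρ u, ρ v⁆)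
    (k : ZMod 2) (m : M) : homAct (br α u) (ρ u) (innerDer ρ k m) = innerDer ρ k (ρ u m) := by
  refine linearMap_ext_bv fun a => ?_
  have hbr : br α u (bv F a) ∈ gr F (par a) := by
    simpa only [zero_add] using br_mem_gr α hu (bv_mem_gr a)
  rw [homAct_apply, innerDer_of_mem_gr ρ k m (bv_mem_gr a), innerDer_of_mem_gr ρ k m hbr,
    innerDer_of_mem_gr ρ k _ (bv_mem_gr a), hρ, Ring.lie_def, map_smul, ← smul_sub]
  simp

lemma IsHomDer.homAct_eq (hφ : IsHomDer α ρ P k φ) (hu : u ∈ gr F 0) :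
    homAct (br α u) (ρ u) φ = innerDer ρ k (φ u) := by
  refine linearMap_ext_bv fun a => ?_
  rw [homAct_apply, hφ.2 0 (par a) u hu _ (bv_mem_gr a), innerDer_of_mem_gr ρ k _ (bv_mem_gr a)]
  simp

lemma IsHomDer.homAct_pow_succ (hφ : IsHomDer α ρ P k φ) (hu : u ∈ gr F 0)
    (hρ : ∀ v, ρ (br α u v) = ⁅ρ u, ρ v⁆) (n : ℕ) :
    (homAct (br α u) (ρ u) ^ (n + 1)) φ = innerDer ρ k ((ρ u ^ n) (φ u)) := by
  induction n with
  | zero => simpa using hφ.homAct_eq hu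
  | succ n ih =>
    rw [pow_succ', Module.End.mul_apply, ih, homAct_innerDer hu hρ, pow_succ' (ρ u),
      Module.End.mul_apply]

end Derivations

section ReducedModule

variable {M : Type*} [AddCommGroup M] [Module F M] {α : F} {p : ℕ} {χ : Module.Dual F (gr F 0)}

lemma ιU_br {u : G F} (hu : u ∈ gr F 0) (v : G F) :
    ιU α p χ (br α u v) = ⁅ιU α p χ u, ιU α p χ v⁆ := by
  suffices ιU α p χ ∘ₗ br α u =
      (LinearMap.mulLeft F (ιU α p χ u) - LinearMap.mulRight F (ιU α p χ u)) ∘ₗ ιU α p χ from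
    LinearMap.congr_fun this v
  refine linearMap_ext_bv fun a => ?_
  have h := RedEnv.lie_rel α p χ ⊤ 0 (par a) ⟨u, trivial⟩ ⟨bv F a, trivial⟩
    ⟨br α u (bv F a), trivial⟩ hu (bv_mem_gr a) rfl
  rw [zero_mul, ZMod.val_zero, pow_zero, one_smul] at h
  exact (sub_eq_of_eq_add' h).symm

lemma ιU_pow_char {u : G F} (hu : u ∈ gr F 0) :
    ιU α p χ u ^ p = ιU α p χ (pMap p u) + algebraMap F _ (χ ⟨u, hu⟩ ^ p) :=
  RedEnv.pow_rel α p χ ⊤ ⟨u, trivial⟩ ⟨pMap p u, trivial⟩ hu rfl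

variable [Module (U α p χ) M] [IsScalarTower F (U α p χ) M]

variable (M α p χ) in
/-- The action of `𝔤` on a module `M` over `u_χ(𝔤)`; for the baby Verma module this is `act`. -/
def redAct : G F →ₗ[F] Module.End F M :=
  (Algebra.lsmul F F M).toLinearMap ∘ₗ ιU α p χ

lemma redAct_br {u : G F} (hu : u ∈ gr F 0) (v : G F) :
    redAct M α p χ (br α u v) = ⁅redAct M α p χ u, redAct M α p χ v⁆ := by
  simp only [redAct, LinearMap.comp_apply, AlgHom.toLinearMap_apply, ιU_br hu, Ring.lie_def,
    map_sub, map_mul]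

lemma redAct_pow_char {u : G F} (hu : u ∈ gr F 0) :
    redAct M α p χ u ^ p = redAct M α p χ (pMap p u) + algebraMap F _ (χ ⟨u, hu⟩ ^ p) := by
  simp only [redAct, LinearMap.comp_apply, AlgHom.toLinearMap_apply, ← map_pow, ιU_pow_char hu,
    map_add, AlgHom.commutes]

variable {P : ZMod 2 → Submodule F M} {k : ZMod 2} {φ : G F →ₗ[F] M} {u : G F}

lemma IsHomDer.smul_eq_innerDer_sub [CharP F p] [hp : Fact p.Prime]
    (hφ : IsHomDer α (redAct M α p χ) P k φ) (hu : u ∈ gr F 0)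
    (hbr : br α u ^ p = br α (pMap p u)) :
    χ ⟨u, hu⟩ ^ p • φ = innerDer (redAct M α p χ) k ((redAct M α p χ u ^ (p - 1)) (φ u)) -
      innerDer (redAct M α p χ) k (φ (pMap p u)) := by
  have hpow := hφ.homAct_pow_succ hu (redAct_br hu) (p - 1)
  rw [Nat.sub_add_cancel hp.out.one_le, homAct_pow_char, hbr, redAct_pow_char hu] at hpow
  rw [← hpow, ← hφ.homAct_eq (pMap_mem_gr p u)]
  refine LinearMap.ext fun v => ?_
  simp only [homAct_apply, LinearMap.sub_apply, LinearMap.add_apply, LinearMap.smul_apply,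
    Module.algebraMap_end_apply]
  abel

lemma IsHomDer.mem_ider [CharP F p] [Fact p.Prime]
    (hφ : IsHomDer α (redAct M α p χ) P k φ) (hu : u ∈ gr F 0)
    (hP : ∀ m ∈ P k, redAct M α p χ u m ∈ P k)
    (hbr : br α u ^ p = br α (pMap p u)) (hχ : χ ⟨u, hu⟩ ≠ 0) :
    φ ∈ Ider (redAct M α p χ) P := by
  have hφP {w : G F} (hw : w ∈ gr F 0) : φ w ∈ P k := by simpa only [add_zero] using hφ.1 0 w hw
  have hpowP (n : ℕ) : (redAct M α p χ u ^ n) (φ u) ∈ P k := by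
    induction n with
    | zero => exact hφP hu
    | succ n ih => rw [pow_succ', Module.End.mul_apply]; exact hP _ ih
  rw [← Submodule.smul_mem_iff _ (pow_ne_zero p hχ), hφ.smul_eq_innerDer_sub hu hbr]
  exact sub_mem (Submodule.subset_span ⟨k, _, hpowP _, rfl⟩)
    (Submodule.subset_span ⟨k, _, hφP (pMap_mem_gr p u), rfl⟩)

lemma exists_apply_bv_ne_zero (hχ : χ ≠ 0) :
    ∃ (a : Idx) (ha : bv F a ∈ gr F 0), par a = 0 ∧ χ ⟨bv F a, ha⟩ ≠ 0 := by
  contrapose! hχ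
  refine LinearMap.ext_on Submodule.span_span_coe_preimage ?_
  rintro ⟨_, hu⟩ ⟨a, ha, rfl⟩
  exact hχ a hu ha

lemma der_le_ider [CharP F p] (hp : 2 < p) (hχ : χ ≠ 0)
    (hP : ∀ k, ∀ u ∈ gr F 0, ∀ m ∈ P k, redAct M α p χ u m ∈ P k) :
    Der α (redAct M α p χ) P ≤ Ider (redAct M α p χ) P := by
  have : Fact p.Prime := ⟨(CharP.char_is_prime_or_zero F p).resolve_right (by omega)⟩
  obtain ⟨a, ha, hpar, hχa⟩ := exists_apply_bv_ne_zero hχ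
  refine Submodule.span_le.mpr ?_
  rintro φ ⟨k, hφ⟩
  exact hφ.mem_ider ha (hP k _ ha) (br_bv_pow_char hp α hpar) hχa

end ReducedModule

section BabyVerma

variable {α : F} {p : ℕ} {χ : Module.Dual F (gr F 0)}

lemma ιU_mul_mem_grU {i j : ZMod 2} {u : G F} {w : U α p χ} (hu : u ∈ gr F i)
    (hw : w ∈ grU α p χ j) : ιU α p χ u * w ∈ grU α p χ (i + j) := by
  induction hu, hw using Submodule.span_induction₂ with
  | mem_mem _ _ ha hw =>
    obtain ⟨a, rfl, rfl⟩ := ha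
    obtain ⟨w, rfl, rfl⟩ := hw
    exact Submodule.subset_span ⟨a :: w, by simp, by simp⟩
  | zero_left _ _ => simp
  | zero_right _ _ => simp
  | add_left _ _ _ _ _ _ h₁ h₂ => simpa only [map_add, add_mul] using add_mem h₁ h₂
  | add_right _ _ _ _ _ _ h₁ h₂ => simpa only [mul_add] using add_mem h₁ h₂
  | smul_left c _ _ _ _ h => simpa using Submodule.smul_mem _ c h
  | smul_right c _ _ _ _ h => simpa using Submodule.smul_mem _ c h

lemma redAct_mem_grZ (hχ : ∀ v : gr F 0, (v : G F) ∈ nplus F → χ v = 0)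
    (l : Module.Dual F (cartan F)) (hl : l ∈ weightSet p χ) {i j : ZMod 2} {u : G F}
    {m : Z α p χ hχ l hl} (hu : u ∈ gr F i) (hm : m ∈ grZ α p χ hχ l hl j) :
    redAct (Z α p χ hχ l hl) α p χ u m ∈ grZ α p χ hχ l hl (i + j) := by
  induction hm using Submodule.span_induction with
  | mem _ hw =>
    obtain ⟨w, hw, rfl⟩ := hw
    exact Submodule.subset_span ⟨_, ιU_mul_mem_grU hu hw, rfl⟩
  | zero => simp
  | add _ _ _ _ h₁ h₂ => simpa only [map_add] using add_mem h₁ h₂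
  | smul c _ _ h => simpa only [map_smul] using Submodule.smul_mem _ c h

end BabyVerma

end D21

theorem proposition3p3_general {F : Type*} [Field F] {p : ℕ} [CharP F p] (hp : 2 < p) {α : F}
    {χ : Module.Dual F (D21.gr F 0)} (hχ : χ ≠ 0) {M : Type*} [AddCommGroup M] [Module F M]
    [Module (D21.U α p χ) M] [IsScalarTower F (D21.U α p χ) M] {P : ZMod 2 → Submodule F M}
    (hP : ∀ k, ∀ u ∈ D21.gr F 0, ∀ m ∈ P k, D21.redAct M α p χ u m ∈ P k) :
    (∀ φ ∈ D21.Der0 α (D21.redAct M α p χ) P, φ ∈ D21.Ider0 α (D21.redAct M α p χ) P) ∧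
    Subsingleton (D21.H1 α (D21.redAct M α p χ) P) := by
  have hinner := D21.der_le_ider hp hχ hP
  exact ⟨fun φ hφ => ⟨hinner hφ.1, hφ.2⟩,
    Submodule.Quotient.subsingleton_iff.mpr (Submodule.submoduleOf_eq_top.mpr hinner)⟩

theorem proposition3p3 {F : Type*} [Field F] [IsAlgClosed F] (p : ℕ) [CharP F p] (hp : 3 < p)
    (α : F) (hα₀ : α ≠ 0) (hα₁ : α ≠ -1)
    (χ : Module.Dual F (D21.gr F 0))
    (hχ : ∀ v : D21.gr F 0, (v : D21.G F) ∈ D21.nplus F → χ v = 0)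
    (l : Module.Dual F (D21.cartan F)) (hl : l ∈ D21.weightSet p χ)
    (hf : χ ⟨D21.bv F (D21.Idx.f 0), D21.bv_f_mem_gr 0⟩ ^ p ≠ 0) :
    (∀ φ ∈ D21.Der0 α (D21.act α p χ hχ l hl) (D21.grZ α p χ hχ l hl),
      φ ∈ D21.Ider0 α (D21.act α p χ hχ l hl) (D21.grZ α p χ hχ l hl)) ∧
    Subsingleton (D21.H1 α (D21.act α p χ hχ l hl) (D21.grZ α p χ hχ l hl)) := by
  have hχ₀ : χ ≠ 0 := by
    rintro rfl
    exact hf (zero_pow (by omega))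
  exact proposition3p3_general (by omega) hχ₀ fun k u hu m hm => by
    simpa only [zero_add] using D21.redAct_mem_grZ hχ l hl hu hm
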